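/- For an integer $j\ge 0$ let $H_j=\mathrm{Sym}^j(\mathbb C^2)\subset(\mathbb C^2)^{\otimes j}$ be the Hilbert space of symmetric tensors and let $\pi_j$ be the irreducible unitary representation of $\mathrm{SU}(2)$ on $H_j$ obtained by restricting $u\mapsto u^{\otimes j}$ (so $j$ is the Dynkin label, the spin is $j/2$ and $\dim H_j=j+1$). For integers $j,k,l\ge 0$ let $\mathbb P^l_{j,k}$ be the orthogonal projection of $H_j\otimes H_k$ onto the isotypic component of type $\pi_l$ of the diagonal representation $u\mapsto\pi_j(u)\otimes\pi_k(u)$ of $\mathrm{SU}(2)$, and define the quasicharacter $$\chi^l_{j,k}(u,v)=\mathrm{Tr}\big(\mathbb P^l_{j,k}\,(\pi_j(u)\otimes\pi_k(v))\big),\qquad u,v\in \mathrm{SU}(2).$$ Then $\chi^1_{1,0}(u,v)=\mathrm{Tr}(u)$, and for every integer $j\ge 0$ and all $u,v\in\mathrm{SU}(2)$, $$\chi^1_{1,0}(u,v)\,\chi^{j+1}_{j,1}(u,v)=\chi^{j+2}_{j+1,1}(u,v)+\frac{1}{(j+1)^2}\,\chi^{j}_{j+1,1}(u,v)+\frac{j(j+2)}{(j+1)^2}\,\chi^{j}_{j-1,1}(u,v)+0\cdot\chi^{j-2}_{j-1,1}(u,v),$$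 where a term whose labels include a negative number is read as $0$ (this concerns the third term for $j=0$ and the fourth term for $j\le 1$; their coefficients vanish anyway). Moreover, the coefficients of this expansion are uniquely determined: if complex numbers $c_1,c_2,c_3,c_4$ satisfy $$\chi^1_{1,0}\,\chi^{j+1}_{j,1}=c_1\chi^{j+2}_{j+1,1}+c_2\chi^{j}_{j+1,1}+c_3\chi^{j}_{j-1,1}+c_4\chi^{j-2}_{j-1,1}$$ on $\mathrm{SU}(2)\times\mathrm{SU}(2)$, then $c_1=1$, $c_2=\frac1{(j+1)^2}$, $c_3=\frac{j(j+2)}{(j+1)^2}$ if $j\ge1$, and $c_4=0$ if $j\ge 2$. -/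

import Mathlib

open scoped TensorProduct

namespace Quasicharacter

noncomputable section

/-- The compact group `SU(2)`. -/
abbrev SU2 : Type := Matrix.specialUnitaryGroup (Fin 2) ℂ

/-- The tensor power `(ℂ²)^{⊗ j}` as a Hilbert space: a tensor is given by its components
`x (a₁, …, a_j)`, with `a_i ∈ {0, 1}`, in the standard orthonormal basis. -/
abbrev TensorPower (j : ℕ) : Type := EuclideanSpace ℂ (Fin j → Fin 2)

/-- The matrix of `m ⊗ ⋯ ⊗ m` (`j` factors). -/
def tensorPowerMatrix (j : ℕ) (m : Matrix (Fin 2) (Fin 2) ℂ) :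
    Matrix (Fin j → Fin 2) (Fin j → Fin 2) ℂ :=
  Matrix.of fun a b => ∏ i, m (a i) (b i)

theorem tensorPowerMatrix_one (j : ℕ) : tensorPowerMatrix j 1 = 1 := by
  ext a b
  simp only [tensorPowerMatrix, Matrix.of_apply, Matrix.one_apply, Finset.prod_ite_zero,
    Finset.prod_const_one, Finset.mem_univ, true_implies, funext_iff]

theorem tensorPowerMatrix_mul (j : ℕ) (m n : Matrix (Fin 2) (Fin 2) ℂ) :
    tensorPowerMatrix j (m * n) = tensorPowerMatrix j m * tensorPowerMatrix j n := by
  ext a b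
  simp only [tensorPowerMatrix, Matrix.of_apply, Matrix.mul_apply, Finset.prod_univ_sum,
    Fintype.piFinset_univ, Finset.prod_mul_distrib]

/-- The symmetric tensors in `(ℂ²)^{⊗ j}`, i.e. those invariant under all permutations of the
tensor factors. -/
def symmetricTensors (j : ℕ) : Submodule ℂ (TensorPower j) where
  carrier := {x | ∀ (σ : Equiv.Perm (Fin j)) (a : Fin j → Fin 2), x (a ∘ σ) = x a}
  add_mem' hx hy σ a := by simp [hx σ a, hy σ a]
  zero_mem' σ a := by simp
  smul_mem' c x hx σ a := by simp [hx σ a]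

theorem tensorPowerMatrix_mem (j : ℕ) (m : Matrix (Fin 2) (Fin 2) ℂ) (x : TensorPower j)
    (hx : x ∈ symmetricTensors j) :
    Matrix.toEuclideanLin (tensorPowerMatrix j m) x ∈ symmetricTensors j := by
  intro σ a
  simp only [Matrix.toLpLin_apply, Matrix.mulVec, dotProduct, tensorPowerMatrix, Matrix.of_apply]
  refine Fintype.sum_equiv (Equiv.arrowCongr σ (Equiv.refl (Fin 2))) _ _ fun b => ?_
  congr 1
  · rw [← Equiv.prod_comp σ (fun i => m (a i) (_))]
    simp
  · exact (hx σ.symm b).symm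

/-- The Hilbert space `H_j` of Dynkin label `j` (spin `j/2`, dimension `j + 1`): the symmetric
tensors, with the inner product inherited from `(ℂ²)^{⊗ j}`. -/
def H (j : ℕ) : Type := symmetricTensors j

instance (j : ℕ) : NormedAddCommGroup (H j) :=
  inferInstanceAs (NormedAddCommGroup (symmetricTensors j))

instance (j : ℕ) : InnerProductSpace ℂ (H j) :=
  inferInstanceAs (InnerProductSpace ℂ (symmetricTensors j))

instance (j : ℕ) : FiniteDimensional ℂ (H j) :=
  inferInstanceAs (FiniteDimensional ℂ (symmetricTensors j))

/-- The linear map that `m ⊗ ⋯ ⊗ m` induces on the symmetric tensors. -/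
def symmetricPower (j : ℕ) (m : Matrix (Fin 2) (Fin 2) ℂ) : H j →ₗ[ℂ] H j :=
  (Matrix.toEuclideanLin (tensorPowerMatrix j m)).restrict (tensorPowerMatrix_mem j m)

theorem symmetricPower_one (j : ℕ) : symmetricPower j 1 = 1 := by
  refine LinearMap.ext fun x => Subtype.ext ?_
  change Matrix.toEuclideanLin (tensorPowerMatrix j 1) x.1 = x.1
  simp [tensorPowerMatrix_one]

theorem symmetricPower_mul (j : ℕ) (m n : Matrix (Fin 2) (Fin 2) ℂ) :
    symmetricPower j (m * n) = symmetricPower j m * symmetricPower j n := by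
  refine LinearMap.ext fun x => Subtype.ext ?_
  change Matrix.toEuclideanLin (tensorPowerMatrix j (m * n)) x.1 =
    Matrix.toEuclideanLin (tensorPowerMatrix j m) (Matrix.toEuclideanLin (tensorPowerMatrix j n) x.1)
  simp [tensorPowerMatrix_mul]

/-- The irreducible representation `π_j` of `SU(2)` of spin `j/2`: the restriction of
`u ⊗ ⋯ ⊗ u` to the symmetric tensors. -/
def rep (j : ℕ) : Representation ℂ SU2 (H j) where
  toFun u := symmetricPower j (u : Matrix (Fin 2) (Fin 2) ℂ)
  map_one' := symmetricPower_one j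
  map_mul' u v := symmetricPower_mul j u v

/-- The isotypic component of Dynkin label `l` of the diagonal representation
`u ↦ π_j(u) ⊗ π_k(u)` of `SU(2)` on `H_j ⊗ H_k`: the sum of the images of all
`SU(2)`-equivariant linear maps `H_l → H_j ⊗ H_k`. It is zero if `H_l` does not occur. -/
def isotypicComponent (j k l : ℕ) : Submodule ℂ (H j ⊗[ℂ] H k) :=
  ⨆ f : Representation.IntertwiningMap (rep l) ((rep j).tprod (rep k)),
    LinearMap.range f.toLinearMap

/-- The projector `ℙ^l_{j,k}`: the orthogonal projection of the Hilbert space `H_j ⊗ H_k` onto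
its isotypic component of Dynkin label `l`. -/
def projector (j k l : ℕ) : (H j ⊗[ℂ] H k) →ₗ[ℂ] (H j ⊗[ℂ] H k) :=
  ((isotypicComponent j k l).starProjection : (H j ⊗[ℂ] H k) →L[ℂ] (H j ⊗[ℂ] H k))

/-- The irreducible quasicharacter `χ^l_{j,k}(u, v) = Tr(ℙ^l_{j,k} ∘ (π_j(u) ⊗ π_k(v)))`
for `N = 2`, in Dynkin labels; the arguments are in the order `j k l`. -/
def chi (j k l : ℕ) (u v : SU2) : ℂ :=
  LinearMap.trace ℂ (H j ⊗[ℂ] H k)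
    (projector j k l ∘ₗ TensorProduct.map (rep j u) (rep k v))

end

end Quasicharacter

/-!
With `a_b`, `a†_b` the annihilation and creation operators on `⨁ H n`, the maps
`x ↦ ∑ b, a_b x ⊗ e_b` and `x ↦ a†_1 x ⊗ e_0 - a†_0 x ⊗ e_1` embed `H (n + 1)` and `H (n - 1)`
equivariantly into `H n ⊗ H 1`, and the canonical commutation relations resolve the identity into
two maps with range in their images. Isotypic components of different labels are orthogonal: the
weights of the diagonal torus on `H m` are too small to accommodate the highest weight vector of
`H l` when `m < l`, so there is no nonzero intertwiner `H l → H m`, and unitarity excludes the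
opposite direction. Hence these two maps are the projectors. It follows that
`(n + 1) χ^{n+1}_{n,1}(u, v) = tr (v T_n(u))`, where `T_n(u)` is the matrix of the traces of
`a_b a†_c π_n(u)`. The commutation relations give `T_{n+1} = s_{n+1} + u T_n`, with `s_n` the
character of `π_n`; together with the Cayley–Hamilton theorem for `u` this yields a three-term
recursion for `T_n`, which is the product formula.

For uniqueness, `χ^{n±1}_{n,1}` restricts on the diagonal `v = u` to the character `s_{n±1}`, where
`s_{-1} = 0`, and on `v = 1` to a multiple of `s_n`, nonzero except for the label `n - 1` when
`n = 0`. The characters are linearly independent because `s_n` is the Chebyshev polynomial `U_n`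
in `tr u / 2`. So a relation between quasicharacters first loses the term `χ^{n+1}_{n,1}` of
largest `n`, by restriction to `v = u`, and then the term `χ^{n-1}_{n,1}`, by restriction to
`v = 1`.
-/

namespace Quasicharacter

noncomputable section

/-! ### Coordinates of symmetric tensors -/

/-- The component of a symmetric tensor at a multi-index. -/
def coord {n : ℕ} (a : Fin n → Fin 2) : H n →ₗ[ℂ] ℂ where
  toFun x := x.1 a
  map_add' _ _ := rfl
  map_smul' _ _ := rfl

@[ext]
theorem H.ext {n : ℕ} {x y : H n} (h : ∀ a, coord a x = coord a y) : x = y :=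
  Subtype.ext (PiLp.ext h)

theorem coord_comp_perm {n : ℕ} (x : H n) (σ : Equiv.Perm (Fin n)) (a : Fin n → Fin 2) :
    coord (a ∘ σ) x = coord a x := x.2 σ a

theorem coord_comp_eq_of_forall_ne {n : ℕ} (x : H n) (a : Fin (n + 1) → Fin 2) {p : Fin (n + 1)}
    {f : Fin n → Fin (n + 1)} (hf : Function.Injective f) (hp : ∀ k, f k ≠ p) :
    coord (a ∘ f) x = coord (a ∘ p.succAbove) x := by
  choose τ hτ using fun k => Fin.exists_succAbove_eq (hp k)
  have τ_injective : Function.Injective τ := fun k l h => hf (by rw [← hτ k, ← hτ l, h])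
  rw [← coord_comp_perm x (Equiv.ofBijective τ (Finite.injective_iff_bijective.1 τ_injective))
    (a ∘ p.succAbove)]
  congr 2
  ext k
  simp [hτ]

/-- The symmetric tensor with prescribed components. -/
def ofCoord {n : ℕ} (f : (Fin n → Fin 2) → ℂ)
    (hf : ∀ (σ : Equiv.Perm (Fin n)) (a : Fin n → Fin 2), f (a ∘ σ) = f a) : H n :=
  ⟨WithLp.toLp 2 f, hf⟩

@[simp]
theorem coord_ofCoord {n : ℕ} (f : (Fin n → Fin 2) → ℂ) (hf) (a : Fin n → Fin 2) :
    coord a (ofCoord f hf) = f a := rfl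

theorem coord_rep {n : ℕ} (u : SU2) (x : H n) (a : Fin n → Fin 2) :
    coord a (rep n u x) = ∑ b, (∏ i, u.1 (a i) (b i)) * coord b x := by
  change (Matrix.toEuclideanLin (tensorPowerMatrix n u.1) x.1) a = _
  simp only [Matrix.toLpLin_apply, Matrix.mulVec, dotProduct, tensorPowerMatrix, Matrix.of_apply]
  rfl

theorem rep_zero (u : SU2) : rep 0 u = 1 := by
  ext x a
  simp [coord_rep, Subsingleton.elim _ a]

/-- The standard basis vectors of `H 1 = ℂ²`. -/
def e (b : Fin 2) : H 1 :=
  ofCoord (fun a => if a 0 = b then 1 else 0) fun σ a => by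
    rw [Function.comp_apply, Subsingleton.elim (σ 0) 0]

theorem coord_e (a : Fin 1 → Fin 2) (b : Fin 2) : coord a (e b) = if a 0 = b then 1 else 0 := rfl

theorem sum_coord_smul_e (x : H 1) : ∑ b, coord (fun _ => b) x • e b = x := by
  ext a
  have ha : a = fun _ => a 0 := funext fun i => by rw [Subsingleton.elim i 0]
  simp only [map_sum, map_smul, coord_e, smul_eq_mul, mul_ite, mul_one, mul_zero,
    Finset.sum_ite_eq, Finset.mem_univ, if_true]
  rw [← ha]

theorem coord_rep_e (v : SU2) (b c : Fin 2) : coord (fun _ => c) (rep 1 v (e b)) = v.1 c b := by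
  rw [coord_rep, ← (Equiv.funUnique (Fin 1) (Fin 2)).symm.sum_comp]
  fin_cases b <;> simp [coord_e]

theorem rep_e (v : SU2) (b : Fin 2) : rep 1 v (e b) = ∑ c, v.1 c b • e c := by
  rw [← sum_coord_smul_e (rep 1 v (e b))]
  simp only [coord_rep_e]

theorem tensor_hom_ext {M V : Type*} [AddCommGroup M] [Module ℂ M] [AddCommGroup V] [Module ℂ V]
    {f g : V ⊗[ℂ] H 1 →ₗ[ℂ] M} (h : ∀ x b, f (x ⊗ₜ e b) = g (x ⊗ₜ e b)) : f = g := by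
  refine TensorProduct.ext' fun x y => ?_
  rw [← sum_coord_smul_e y]
  simp only [TensorProduct.tmul_sum, TensorProduct.tmul_smul, map_sum, map_smul, h]

/-! ### Creation and annihilation operators -/

/-- The annihilation operator `a_b`: contraction of one tensor factor with the `b`-th
coordinate. -/
def annihilation (n : ℕ) (b : Fin 2) : H (n + 1) →ₗ[ℂ] H n where
  toFun x := ofCoord (fun a => coord (Fin.cons b a) x) fun σ a => by
    rw [← coord_comp_perm x (Equiv.Perm.decomposeFin.symm (0, σ)) (Fin.cons b a)]
    congr 2
    funext i
    refine Fin.cases ?_ (fun k => ?_) i <;> simp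
  map_add' x y := by ext a; simp
  map_smul' c x := by ext a; simp

/-- The creation operator `a†_b`: symmetrized product with the `b`-th basis vector, without the
factor `1 / (n + 1)` of the symmetrization. -/
def creation (n : ℕ) (b : Fin 2) : H n →ₗ[ℂ] H (n + 1) where
  toFun x := ofCoord (fun a => ∑ i, if a i = b then coord (a ∘ i.succAbove) x else 0)
    fun σ a => by
      rw [← Equiv.sum_comp σ fun i => if a i = b then coord (a ∘ i.succAbove) x else 0]
      refine Finset.sum_congr rfl fun i _ => ?_
      have comp_succAbove : coord (a ∘ σ ∘ i.succAbove) x = coord (a ∘ (σ i).succAbove) x :=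
        coord_comp_eq_of_forall_ne x a (σ.injective.comp Fin.succAbove_right_injective)
          fun k => by simp
      rw [Function.comp_assoc, comp_succAbove, Function.comp_apply]
  map_add' x y := by
    ext a
    simp only [map_add, coord_ofCoord, ← Finset.sum_add_distrib, ← ite_add_zero]
  map_smul' c x := by
    ext a
    simp [Finset.mul_sum]

theorem coord_annihilation {n : ℕ} (b : Fin 2) (x : H (n + 1)) (a : Fin n → Fin 2) :
    coord a (annihilation n b x) = coord (Fin.cons b a) x := rfl

theorem coord_creation {n : ℕ} (b : Fin 2) (x : H n) (a : Fin (n + 1) → Fin 2) :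
    coord a (creation n b x) = ∑ i, if a i = b then coord (a ∘ i.succAbove) x else 0 := rfl

theorem annihilation_creation_zero (b c : Fin 2) (x : H 0) :
    annihilation 0 b (creation 0 c x) = if b = c then x else 0 := by
  ext a
  rw [coord_annihilation, coord_creation, Fin.sum_univ_one, Fin.cons_zero, apply_ite (coord a),
    map_zero]
  congr 2

theorem annihilation_creation_succ (n : ℕ) (b c : Fin 2) (x : H (n + 1)) :
    annihilation (n + 1) b (creation (n + 1) c x) =
      (if b = c then x else 0) + creation n c (annihilation n b x) := by
  ext a
  have cons_comp_succAbove (i : Fin (n + 1)) :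
      (Fin.cons b a : Fin (n + 2) → Fin 2) ∘ i.succ.succAbove = Fin.cons b (a ∘ i.succAbove) := by
    funext k
    refine Fin.cases ?_ (fun k => ?_) k <;> simp
  rw [coord_annihilation, coord_creation, Fin.sum_univ_succ, map_add, coord_creation,
    apply_ite (coord a), map_zero]
  simp only [Fin.cons_succ, cons_comp_succAbove, coord_annihilation]
  rfl

theorem sum_creation_annihilation (n : ℕ) (x : H (n + 1)) :
    ∑ b, creation n b (annihilation n b x) = ((n : ℂ) + 1) • x := by
  ext a
  have coord_cons_removeNth (i : Fin (n + 1)) :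
      coord (Fin.cons (a i) (a ∘ i.succAbove)) x = coord a x := by
    rw [← coord_comp_perm x i.cycleRange, Fin.cons_comp_cycleRange]
    congr 2
    exact Fin.insertNth_self_removeNth i a
  simp only [map_sum, coord_creation, coord_annihilation]
  rw [Finset.sum_comm]
  simp [coord_cons_removeNth]

theorem sum_annihilation_creation (n : ℕ) (x : H n) :
    ∑ b, annihilation n b (creation n b x) = ((n : ℂ) + 2) • x := by
  cases n with
  | zero => simp [annihilation_creation_zero, two_smul]
  | succ n =>
    simp only [annihilation_creation_succ, Finset.sum_add_distrib, sum_creation_annihilation,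
      if_true]
    rw [Fin.sum_univ_two]
    push_cast
    module

theorem annihilation_rep (n : ℕ) (c : Fin 2) (u : SU2) (x : H (n + 1)) :
    annihilation n c (rep (n + 1) u x) = ∑ b, u.1 c b • rep n u (annihilation n b x) := by
  ext a
  simp only [map_sum, map_smul, coord_annihilation, coord_rep, smul_eq_mul]
  rw [← (Fin.consEquiv fun _ => Fin 2).sum_comp, Fintype.sum_prod_type]
  simp [Fin.consEquiv, Fin.prod_univ_succ, Finset.mul_sum, mul_assoc]

theorem rep_creation (n : ℕ) (b : Fin 2) (u : SU2) (x : H n) :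
    rep (n + 1) u (creation n b x) = ∑ c, u.1 c b • creation n c (rep n u x) := by
  ext a
  simp only [map_sum, map_smul, coord_creation, coord_rep, smul_eq_mul, Finset.mul_sum]
  rw [Finset.sum_comm, Finset.sum_comm (s := (Finset.univ : Finset (Fin 2)))]
  refine Finset.sum_congr rfl fun k _ => ?_
  rw [← (Fin.insertNthEquiv (fun _ => Fin 2) k).sum_comp, Fintype.sum_prod_type]
  simp only [Fin.insertNthEquiv_apply, Fin.prod_univ_succAbove _ k, Fin.insertNth_apply_same,
    Fin.insertNth_apply_succAbove, mul_ite, mul_zero, Finset.sum_ite_irrel,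
    Finset.sum_const_zero, Finset.sum_ite_eq, Finset.mem_univ, if_true,
    Finset.mul_sum, Finset.sum_ite_eq', mul_assoc]
  refine Finset.sum_congr rfl fun d _ => ?_
  congr 4
  ext i
  simp

/-! ### Clebsch–Gordan embeddings -/

/-- The Clebsch–Gordan embedding of `H (n + 1)` into `H n ⊗ H 1`, up to scale. -/
def upperEmbedding (n : ℕ) : (rep (n + 1)).IntertwiningMap ((rep n).tprod (rep 1)) where
  toLinearMap := ∑ b, (TensorProduct.mk ℂ (H n) (H 1)).flip (e b) ∘ₗ annihilation n b
  isIntertwining' u := by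
    ext1 x
    simp only [LinearMap.comp_apply, LinearMap.sum_apply, LinearMap.flip_apply,
      TensorProduct.mk_apply, annihilation_rep, map_sum, Representation.tprod_apply,
      TensorProduct.map_tmul, rep_e, TensorProduct.tmul_sum,
      TensorProduct.tmul_smul, TensorProduct.smul_tmul']
    exact Finset.sum_comm

theorem upperEmbedding_apply (n : ℕ) (x : H (n + 1)) :
    upperEmbedding n x = ∑ b, annihilation n b x ⊗ₜ e b :=
  LinearMap.sum_apply _ _ _

theorem det_eq_one (u : SU2) : u.1 0 0 * u.1 1 1 - u.1 0 1 * u.1 1 0 = 1 := by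
  rw [← Matrix.det_fin_two]
  exact (Matrix.mem_specialUnitaryGroup_iff.1 u.2).2

/-- The Clebsch–Gordan embedding of `H n` into `H (n + 1) ⊗ H 1`, up to scale. -/
def lowerEmbedding (n : ℕ) : (rep n).IntertwiningMap ((rep (n + 1)).tprod (rep 1)) where
  toLinearMap := (TensorProduct.mk ℂ (H (n + 1)) (H 1)).flip (e 0) ∘ₗ creation n 1 -
    (TensorProduct.mk ℂ (H (n + 1)) (H 1)).flip (e 1) ∘ₗ creation n 0
  isIntertwining' u := by
    ext1 x
    simp only [LinearMap.comp_apply, LinearMap.sub_apply, LinearMap.flip_apply,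
      TensorProduct.mk_apply, map_sub, Representation.tprod_apply,
      TensorProduct.map_tmul, rep_e, rep_creation, Fin.sum_univ_two, TensorProduct.tmul_add,
      TensorProduct.add_tmul, TensorProduct.tmul_smul, ← TensorProduct.smul_tmul']
    linear_combination (norm := module) (-det_eq_one u) •
      (creation n 1 (rep n u x) ⊗ₜ[ℂ] e 0 - creation n 0 (rep n u x) ⊗ₜ[ℂ] e 1)

theorem lowerEmbedding_apply (n : ℕ) (x : H n) :
    lowerEmbedding n x = creation n 1 x ⊗ₜ e 0 - creation n 0 x ⊗ₜ e 1 := rfl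

/-- The contraction `H n ⊗ H 1 → H (n + 1)` given by the symmetrized product. -/
def upperContraction (n : ℕ) : H n ⊗[ℂ] H 1 →ₗ[ℂ] H (n + 1) :=
  TensorProduct.lift (∑ b, ((coord fun _ => b).smulRight (creation n b)).flip)

/-- The contraction `H (n + 1) ⊗ H 1 → H n` by the `SU(2)`-invariant symplectic form on `ℂ²`. -/
def lowerContraction (n : ℕ) : H (n + 1) ⊗[ℂ] H 1 →ₗ[ℂ] H n :=
  TensorProduct.lift (((coord fun _ => 0).smulRight (annihilation n 1)).flip -
    ((coord fun _ => 1).smulRight (annihilation n 0)).flip)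

theorem upperContraction_tmul (n : ℕ) (x : H n) (y : H 1) :
    upperContraction n (x ⊗ₜ y) = ∑ b, coord (fun _ => b) y • creation n b x := by
  simp [upperContraction]

theorem lowerContraction_tmul (n : ℕ) (x : H (n + 1)) (y : H 1) :
    lowerContraction n (x ⊗ₜ y) =
      coord (fun _ => 0) y • annihilation n 1 x - coord (fun _ => 1) y • annihilation n 0 x := rfl

theorem upperEmbedding_comp_upperContraction_zero :
    (upperEmbedding 0).toLinearMap ∘ₗ upperContraction 0 = LinearMap.id := by
  refine tensor_hom_ext fun x b => ?_
  change upperEmbedding 0 _ = _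
  fin_cases b <;>
    simp [upperContraction_tmul, upperEmbedding_apply, coord_e, annihilation_creation_zero]

theorem upperEmbedding_comp_upperContraction_add (n : ℕ) :
    (upperEmbedding (n + 1)).toLinearMap ∘ₗ upperContraction (n + 1) +
      (lowerEmbedding n).toLinearMap ∘ₗ lowerContraction n =
        ((n : ℂ) + 2) • LinearMap.id := by
  refine tensor_hom_ext fun x b => ?_
  change upperEmbedding (n + 1) _ + lowerEmbedding n _ = ((n : ℂ) + 2) • x ⊗ₜ e b
  have number_operator :
      creation n 1 (annihilation n 1 x) =
        ((n : ℂ) + 1) • x - creation n 0 (annihilation n 0 x) := by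
    rw [← sum_creation_annihilation, Fin.sum_univ_two, add_sub_cancel_left]
  fin_cases b <;>
  · simp only [Fin.zero_eta, Fin.mk_one, upperContraction_tmul, lowerContraction_tmul, coord_e,
      ite_smul, one_smul, zero_smul, Finset.sum_ite_eq', Finset.mem_univ, if_true, one_ne_zero,
      zero_ne_one, if_false, upperEmbedding_apply, lowerEmbedding_apply,
      annihilation_creation_succ, number_operator, Fin.sum_univ_two, map_sub, map_zero,
      TensorProduct.add_tmul, TensorProduct.sub_tmul, TensorProduct.zero_tmul,
      ← TensorProduct.smul_tmul']
    module

/-- The projection of `H n ⊗ H 1` onto its component `H (n + 1)`. -/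
def upperProjection (n : ℕ) : H n ⊗[ℂ] H 1 →ₗ[ℂ] H n ⊗[ℂ] H 1 :=
  (upperEmbedding n).toLinearMap ∘ₗ (((n : ℂ) + 1)⁻¹ • upperContraction n)

theorem range_le_isotypicComponent {j k l : ℕ}
    (f : (rep l).IntertwiningMap ((rep j).tprod (rep k))) :
    LinearMap.range f.toLinearMap ≤ isotypicComponent j k l :=
  le_iSup (fun f : (rep l).IntertwiningMap ((rep j).tprod (rep k)) =>
    LinearMap.range f.toLinearMap) f

theorem range_upperProjection_le (n : ℕ) :
    LinearMap.range (upperProjection n) ≤ isotypicComponent n 1 (n + 1) :=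
  (LinearMap.range_comp_le_range _ _).trans (range_le_isotypicComponent _)

theorem range_id_sub_upperProjection_le (n : ℕ) :
    LinearMap.range (LinearMap.id - upperProjection n) ≤ isotypicComponent n 1 (n - 1) := by
  cases n with
  | zero => simp [upperProjection, upperEmbedding_comp_upperContraction_zero]
  | succ n =>
    have hn : (n : ℂ) + 2 ≠ 0 := by exact_mod_cast (n + 1).succ_ne_zero
    have id_sub_upperProjection : LinearMap.id - upperProjection (n + 1) =
        (lowerEmbedding n).toLinearMap ∘ₗ (((n : ℂ) + 2)⁻¹ • lowerContraction n) := by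
      rw [sub_eq_iff_eq_add', upperProjection, LinearMap.comp_smul, LinearMap.comp_smul,
        Nat.cast_succ, add_assoc, one_add_one_eq_two, ← smul_add,
        upperEmbedding_comp_upperContraction_add, inv_smul_smul₀ hn]
    rw [id_sub_upperProjection]
    exact (LinearMap.range_comp_le_range _ _).trans (range_le_isotypicComponent _)

/-! ### Orthogonality of isotypic components -/

section Unitary

variable {G U V W : Type*} [Group G] [AddCommGroup U] [Module ℂ U]
  [NormedAddCommGroup V] [InnerProductSpace ℂ V] [FiniteDimensional ℂ V]
  [NormedAddCommGroup W] [InnerProductSpace ℂ W] [FiniteDimensional ℂ W]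

/-- A representation on a finite-dimensional Hilbert space is unitary if every group element acts
by a unitary operator; `ρ g⁻¹` is the inverse of `ρ g`. -/
def IsUnitary (ρ : Representation ℂ G V) : Prop :=
  ∀ g, LinearMap.adjoint (ρ g) = ρ g⁻¹

theorem IsUnitary.tprod {ρ : Representation ℂ G V} {σ : Representation ℂ G W}
    (hρ : IsUnitary ρ) (hσ : IsUnitary σ) : IsUnitary (ρ.tprod σ) := fun g => by
  simp only [Representation.tprod_apply, TensorProduct.adjoint_map, hρ g, hσ g]

/-- The adjoint of an intertwiner of unitary representations. -/
def adjointIntertwiningMap {ρ : Representation ℂ G V} {σ : Representation ℂ G W}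
    (hρ : IsUnitary ρ) (hσ : IsUnitary σ) (f : ρ.IntertwiningMap σ) : σ.IntertwiningMap ρ where
  toLinearMap := LinearMap.adjoint f.toLinearMap
  isIntertwining' g := by
    rw [← inv_inv g, ← hρ, ← hσ, ← LinearMap.adjoint_comp, ← LinearMap.adjoint_comp,
      f.isIntertwining']

theorem isOrtho_range_of_forall_eq_zero {π : Representation ℂ G U} {ρ : Representation ℂ G V}
    {σ : Representation ℂ G W} (hρ : IsUnitary ρ) (hσ : IsUnitary σ)
    (h : ∀ g : π.IntertwiningMap ρ, g = 0)
    (f₁ : π.IntertwiningMap σ) (f₂ : ρ.IntertwiningMap σ) :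
    LinearMap.range f₁.toLinearMap ⟂ LinearMap.range f₂.toLinearMap := by
  rw [Submodule.isOrtho_iff_inner_eq]
  rintro _ ⟨x, rfl⟩ _ ⟨y, rfl⟩
  have hzero : LinearMap.adjoint f₂.toLinearMap (f₁.toLinearMap x) = 0 :=
    DFunLike.congr_fun (h ((adjointIntertwiningMap hρ hσ f₂).comp f₁)) x
  rw [← LinearMap.adjoint_inner_left, hzero, inner_zero_left]

end Unitary

theorem inner_eq_sum {n : ℕ} (x y : H n) :
    inner ℂ x y = ∑ a, coord a y * star (coord a x) := by
  change inner ℂ x.1 y.1 = _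
  rw [PiLp.inner_apply]
  rfl

theorem isUnitary_rep (n : ℕ) : IsUnitary (rep n) := fun u => by
  symm
  rw [LinearMap.eq_adjoint_iff]
  intro x y
  have star_inv_apply (a b) : star ((u⁻¹ : SU2).1 a b) = u.1 b a := star_star _
  simp only [inner_eq_sum, coord_rep, star_sum, star_mul', star_prod, star_inv_apply,
    Finset.mul_sum, Finset.sum_mul]
  rw [Finset.sum_comm]
  refine Finset.sum_congr rfl fun a _ => Finset.sum_congr rfl fun b _ => ?_
  ring

/-- The tensor power `z ⊗ ⋯ ⊗ z` of a vector `z`. -/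
def powVec (n : ℕ) (z : Fin 2 → ℂ) : H n :=
  ofCoord (fun a => ∏ i, z (a i)) fun σ a => Equiv.prod_comp σ fun i => z (a i)

theorem coord_powVec {n : ℕ} (z : Fin 2 → ℂ) (a : Fin n → Fin 2) :
    coord a (powVec n z) = ∏ i, z (a i) := rfl

theorem rep_powVec (n : ℕ) (u : SU2) (z : Fin 2 → ℂ) :
    rep n u (powVec n z) = powVec n (u.1.mulVec z) := by
  ext a
  simp only [coord_rep, coord_powVec, Matrix.mulVec, dotProduct, Finset.prod_univ_sum,
    Fintype.piFinset_univ, Finset.prod_mul_distrib]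

theorem powVec_smul (n : ℕ) (r : ℂ) (z : Fin 2 → ℂ) :
    powVec n (r • z) = r ^ n • powVec n z := by
  ext a
  simp [coord_powVec, Finset.prod_mul_distrib]

/-- The number of indices equal to `1` in a multi-index. -/
def weight {n : ℕ} (a : Fin n → Fin 2) : ℕ := Fintype.card {i // a i = 1}

theorem prod_apply_eq_pow_weight {n : ℕ} (t : ℂ) (a : Fin n → Fin 2) :
    ∏ i, (![1, t] : Fin 2 → ℂ) (a i) = t ^ weight a := by
  have apply_eq_ite (b : Fin 2) : (![1, t] : Fin 2 → ℂ) b = if b = 1 then t else 1 := by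
    fin_cases b <;> rfl
  simp only [apply_eq_ite, Finset.prod_ite, Finset.prod_const, one_pow, mul_one, weight,
    Fintype.card_subtype]

theorem coord_eq_of_weight_eq {n : ℕ} (x : H n) {a b : Fin n → Fin 2}
    (h : weight a = weight b) : coord a x = coord b x := by
  let τ : {i // b i = 1} ≃ {i // a i = 1} := Fintype.equivOfCardEq h.symm
  rw [← coord_comp_perm x τ.extendSubtype a]
  congr 2
  funext i
  by_cases hi : b i = 1
  · rw [hi]
    exact τ.extendSubtype_mem i hi
  · have : a (τ.extendSubtype i) ≠ 1 := τ.extendSubtype_not_mem i hi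
    rw [Function.comp_apply]
    omega

theorem eq_zero_of_forall_inner_powVec {n : ℕ} (x : H n)
    (h : ∀ t : ℂ, inner ℂ x (powVec n ![1, t]) = 0) : x = 0 := by
  let p : Polynomial ℂ := ∑ a, Polynomial.monomial (weight a) (star (coord a x))
  have p_eq_zero : p = 0 := Polynomial.funext fun t => by
    rw [Polynomial.eval_zero, ← h t, inner_eq_sum]
    simp [p, Polynomial.eval_finsetSum, coord_powVec, prod_apply_eq_pow_weight, mul_comm]
  ext a
  have coeff_eq_zero : p.coeff (weight a) = 0 := by rw [p_eq_zero, Polynomial.coeff_zero]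
  have coeff_eq : p.coeff (weight a) =
      (Finset.univ.filter fun b : Fin n → Fin 2 => weight b = weight a).card •
        star (coord a x) := by
    simp only [p, Polynomial.finsetSum_coeff, Polynomial.coeff_monomial]
    rw [← Finset.sum_filter, Finset.sum_congr rfl fun b hb => ?_, Finset.sum_const]
    rw [coord_eq_of_weight_eq x (Finset.mem_filter.1 hb).2]
  have card_ne_zero :
      (Finset.univ.filter fun b : Fin n → Fin 2 => weight b = weight a).card ≠ 0 :=
    Finset.card_ne_zero_of_mem (Finset.mem_filter.2 ⟨Finset.mem_univ a, rfl⟩)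
  rw [coeff_eq, smul_eq_zero_iff_right card_ne_zero, star_eq_zero] at coeff_eq_zero
  rw [coeff_eq_zero, map_zero]

theorem span_range_powVec (n : ℕ) :
    Submodule.span ℂ (Set.range fun t : ℂ => powVec n ![1, t]) = ⊤ := by
  rw [← Submodule.orthogonal_eq_bot_iff, Submodule.eq_bot_iff]
  exact fun x hx => eq_zero_of_forall_inner_powVec x fun t =>
    (Submodule.mem_orthogonal' _ _).1 hx _ (Submodule.subset_span ⟨t, rfl⟩)

/-- The matrix with rows `(α, -conj β)` and `(β, conj α)`, as an element of `SU(2)`. -/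
def mkSU2 (α β : ℂ) (h : ‖α‖ ^ 2 + ‖β‖ ^ 2 = 1) : SU2 :=
  ⟨!![α, -star β; β, star α], by
    have h' : α * star α + β * star β = 1 := by
      simp only [RCLike.star_def, Complex.mul_conj']
      exact_mod_cast h
    have star_eq : star !![α, -star β; β, star α] = !![star α, star β; -β, α] := by
      ext i j
      fin_cases i <;> fin_cases j <;> simp [Matrix.star_apply]
    rw [Matrix.mem_specialUnitaryGroup_iff, Matrix.mem_unitaryGroup_iff, star_eq,
      Matrix.mul_fin_two, Matrix.det_fin_two_of, Matrix.one_fin_two]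
    have entry₀₀ : α * star α + -star β * -β = 1 := by linear_combination h'
    have entry₀₁ : α * star β + -star β * α = 0 := by ring
    have entry₁₀ : β * star α + star α * -β = 0 := by ring
    have entry₁₁ : β * star β + star α * α = 1 := by linear_combination h'
    rw [entry₀₀, entry₀₁, entry₁₀, entry₁₁]
    exact ⟨rfl, by linear_combination h'⟩⟩

theorem mkSU2_mulVec (α β : ℂ) (h : ‖α‖ ^ 2 + ‖β‖ ^ 2 = 1) :
    (mkSU2 α β h).1.mulVec ![1, 0] = ![α, β] := by
  ext i
  fin_cases i <;> simp [mkSU2, Matrix.mulVec, dotProduct]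

theorem exists_rep_powVec (n : ℕ) (t : ℂ) :
    ∃ (u : SU2) (r : ℂ), r ≠ 0 ∧ rep n u (powVec n ![1, 0]) = r • powVec n ![1, t] := by
  let r : ℝ := (√(1 + ‖t‖ ^ 2))⁻¹
  have r_ne_zero : (r : ℂ) ≠ 0 := Complex.ofReal_ne_zero.2 (by positivity)
  have norm_sq_add : ‖(r : ℂ)‖ ^ 2 + ‖(r * t : ℂ)‖ ^ 2 = 1 := by
    rw [norm_mul, mul_pow, ← mul_one_add, Complex.norm_real, Real.norm_eq_abs, sq_abs, inv_pow,
      Real.sq_sqrt (by positivity), inv_mul_cancel₀ (by positivity)]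
  refine ⟨mkSU2 r (r * t) norm_sq_add, r ^ n, pow_ne_zero n r_ne_zero, ?_⟩
  rw [rep_powVec, mkSU2_mulVec, ← powVec_smul]
  simp

/-- The diagonal matrix `diag(z, z⁻¹)` as an element of `SU(2)`. -/
def diagonalSU2 (z : ℂ) (hz : ‖z‖ = 1) : SU2 := mkSU2 z 0 (by simp [hz])

theorem rep_diagonalSU2_powVec (n : ℕ) {z : ℂ} (hz : ‖z‖ = 1) :
    rep n (diagonalSU2 z hz) (powVec n ![1, 0]) = z ^ n • powVec n ![1, 0] := by
  rw [rep_powVec, diagonalSU2, mkSU2_mulVec, ← powVec_smul]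
  simp

theorem coord_rep_diagonalSU2 {n : ℕ} {z : ℂ} (hz : ‖z‖ = 1) (x : H n) (a : Fin n → Fin 2) :
    coord a (rep n (diagonalSU2 z hz) x) = z ^ n * (z⁻¹ ^ 2) ^ weight a * coord a x := by
  have apply_self (p : Fin 2) :
      (diagonalSU2 z hz).1 p p = z * (![1, z⁻¹ ^ 2] : Fin 2 → ℂ) p := by
    have hz₀ : z ≠ 0 := norm_ne_zero_iff.1 (by simp [hz])
    have conj_eq_inv : star z = z⁻¹ := (Complex.inv_eq_conj hz).symm
    fin_cases p
    · simp [diagonalSU2, mkSU2]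
    · change star z = z * z⁻¹ ^ 2
      rw [conj_eq_inv, sq, mul_inv_cancel_left₀ hz₀]
  have apply_of_ne {p q : Fin 2} (hpq : q ≠ p) : (diagonalSU2 z hz).1 p q = 0 := by
    fin_cases p <;> fin_cases q <;> simp [diagonalSU2, mkSU2] at hpq ⊢
  rw [coord_rep, Finset.sum_eq_single a (fun b _ hb => ?_) (by simp)]
  · simp only [apply_self, Finset.prod_mul_distrib, prod_apply_eq_pow_weight, Finset.prod_const,
      Finset.card_univ, Fintype.card_fin]
  · obtain ⟨i, hi⟩ := Function.ne_iff.1 hb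
    rw [Finset.prod_eq_zero (Finset.mem_univ i) (apply_of_ne hi), zero_mul]

theorem eq_zero_of_rep_diagonalSU2_eq_smul {l m : ℕ} (h : m < l) {x : H m}
    (hx : ∀ z (hz : ‖z‖ = 1), rep m (diagonalSU2 z hz) x = z ^ l • x) : x = 0 := by
  ext a
  by_contra hne
  rw [map_zero] at hne
  have hζ := Complex.isPrimitiveRoot_exp (l + 2 * weight a + 1) (Nat.succ_ne_zero _)
  set ζ := Complex.exp _
  have hζ₁ : ‖ζ‖ = 1 := hζ.norm'_eq_one (Nat.succ_ne_zero _)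
  have pow_eq : ζ ^ m = ζ ^ (l + 2 * weight a) := by
    have := congrArg (coord a) (hx ζ hζ₁)
    rw [coord_rep_diagonalSU2, map_smul, smul_eq_mul] at this
    rw [pow_add, pow_mul, ← mul_right_cancel₀ hne this, mul_assoc, ← mul_pow, ← mul_pow,
      inv_mul_cancel₀ (hζ.ne_zero (Nat.succ_ne_zero _)), one_pow, one_pow, mul_one]
  have := hζ.pow_inj (by omega) (by omega) pow_eq
  omega

theorem intertwiningMap_eq_zero_of_lt {l m : ℕ} (h : m < l)
    (g : (rep l).IntertwiningMap (rep m)) : g = 0 := by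
  have map_rep (u : SU2) (x : H l) : g.toLinearMap (rep l u x) = rep m u (g.toLinearMap x) :=
    DFunLike.congr_fun (g.isIntertwining' u) x
  have highest_weight : g.toLinearMap (powVec l ![1, 0]) = 0 :=
    eq_zero_of_rep_diagonalSU2_eq_smul h fun z hz => by
      rw [← map_rep, rep_diagonalSU2_powVec, map_smul]
  have map_powVec (t : ℂ) : g.toLinearMap (powVec l ![1, t]) = 0 := by
    obtain ⟨u, r, hr, hu⟩ := exists_rep_powVec l t
    have := map_rep u (powVec l ![1, 0])
    rwa [hu, highest_weight, map_zero, map_smul, smul_eq_zero_iff_right hr] at this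
  exact Representation.IntertwiningMap.ext
    (LinearMap.ext_on_range (span_range_powVec l) map_powVec)

theorem isOrtho_isotypicComponent (j k : ℕ) {l m : ℕ} (h : l ≠ m) :
    isotypicComponent j k l ⟂ isotypicComponent j k m := by
  wlog hml : m < l generalizing l m
  · exact (this h.symm (by omega)).symm
  simp only [isotypicComponent, Submodule.isOrtho_iSup_left, Submodule.isOrtho_iSup_right]
  exact fun f₂ f₁ => isOrtho_range_of_forall_eq_zero (isUnitary_rep m)
    ((isUnitary_rep j).tprod (isUnitary_rep k)) (intertwiningMap_eq_zero_of_lt hml) f₁ f₂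

theorem projector_eq_of_add_eq_id {j k l m : ℕ} {P Q : H j ⊗[ℂ] H k →ₗ[ℂ] H j ⊗[ℂ] H k}
    (hlm : l ≠ m) (h : P + Q = LinearMap.id)
    (hP : LinearMap.range P ≤ isotypicComponent j k l)
    (hQ : LinearMap.range Q ≤ isotypicComponent j k m) : projector j k l = P := by
  refine LinearMap.ext fun t => ?_
  have sub_eq : t - P t = Q t := sub_eq_of_eq_add' (LinearMap.congr_fun h t).symm
  refine Submodule.eq_starProjection_of_mem_orthogonal (hP ⟨t, rfl⟩) ?_
  rw [sub_eq]
  exact (isOrtho_isotypicComponent j k hlm).symm (hQ ⟨t, rfl⟩)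

/-! ### Quasicharacters as traces -/

theorem projector_succ (n : ℕ) : projector n 1 (n + 1) = upperProjection n :=
  projector_eq_of_add_eq_id (by omega) (add_sub_cancel _ _) (range_upperProjection_le n)
    (range_id_sub_upperProjection_le n)

theorem projector_pred (n : ℕ) : projector n 1 (n - 1) = LinearMap.id - upperProjection n :=
  projector_eq_of_add_eq_id (by omega) (sub_add_cancel _ _) (range_id_sub_upperProjection_le n)
    (range_upperProjection_le n)

/-- The symmetric tensor `1` of degree `0`. -/
def vacuum : H 0 := ofCoord (fun _ => 1) fun _ _ => rfl

theorem coord_smul_vacuum (y : H 0) : coord Fin.elim0 y • vacuum = y := by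
  ext a
  rw [map_smul, vacuum, coord_ofCoord, smul_eq_mul, mul_one, Subsingleton.elim a]

theorem isotypicComponent_zero (n : ℕ) : isotypicComponent n 0 n = ⊤ := by
  let f : (rep n).IntertwiningMap ((rep n).tprod (rep 0)) :=
    { toLinearMap := (TensorProduct.mk ℂ (H n) (H 0)).flip vacuum
      isIntertwining' := fun u => LinearMap.ext fun x => by simp [rep_zero] }
  refine eq_top_iff.2 (le_trans ?_ (range_le_isotypicComponent f))
  rw [← TensorProduct.span_tmul_eq_top, Submodule.span_le]
  rintro _ ⟨x, y, rfl⟩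
  refine ⟨coord Fin.elim0 y • x, ?_⟩
  change (coord Fin.elim0 y • x) ⊗ₜ[ℂ] vacuum = x ⊗ₜ y
  rw [TensorProduct.smul_tmul, coord_smul_vacuum]

theorem character_rep_zero (u : SU2) : (rep 0).character u = 1 := by
  have one_eq : (1 : H 0 →ₗ[ℂ] H 0) = (coord Fin.elim0).smulRight vacuum :=
    LinearMap.ext fun y => (coord_smul_vacuum y).symm
  rw [Representation.character, rep_zero, one_eq, LinearMap.trace_smulRight, vacuum,
    coord_ofCoord]

theorem chi_zero (n : ℕ) (u v : SU2) : chi n 0 n u v = (rep n).character u := by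
  have projector_eq_id : projector n 0 n = LinearMap.id := by
    simp only [projector, isotypicComponent_zero, Submodule.starProjection_top]
    rfl
  rw [chi, projector_eq_id, LinearMap.id_comp, LinearMap.trace_tensorProduct',
    ← Representation.character, ← Representation.character, character_rep_zero, mul_one]

/-! ### Ladder traces -/

/-- The traces of `a_b ∘ a†_c ∘ π_n(u)`, for annihilation and creation operators `a_b`, `a†_c`. -/
def ladderTrace (n : ℕ) (u : SU2) : Matrix (Fin 2) (Fin 2) ℂ :=
  Matrix.of fun b c => LinearMap.trace ℂ (H n) (annihilation n b ∘ₗ creation n c ∘ₗ rep n u)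

theorem trace_creation_comp_annihilation (n : ℕ) (u : SU2) (b c : Fin 2) :
    LinearMap.trace ℂ _ (creation n c ∘ₗ rep n u ∘ₗ annihilation n b) = ladderTrace n u b c := by
  rw [← LinearMap.comp_assoc, LinearMap.trace_comp_comm']
  rfl

theorem trace_upperProjection_comp_map (n : ℕ) (u v : SU2) :
    LinearMap.trace ℂ _ (upperProjection n ∘ₗ TensorProduct.map (rep n u) (rep 1 v)) =
      ((n : ℂ) + 1)⁻¹ * (v.1 * ladderTrace n u).trace := by
  have contraction_comp_embedding :
      (upperContraction n ∘ₗ TensorProduct.map (rep n u) (rep 1 v)) ∘ₗ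
          (upperEmbedding n).toLinearMap =
        ∑ c, ∑ b, v.1 c b • (creation n c ∘ₗ rep n u ∘ₗ annihilation n b) := by
    refine LinearMap.ext fun x => ?_
    change upperContraction n (TensorProduct.map _ _ (upperEmbedding n x)) = _
    simp only [upperEmbedding_apply, map_sum, TensorProduct.map_tmul, upperContraction_tmul,
      coord_rep_e, LinearMap.sum_apply, LinearMap.smul_apply, LinearMap.comp_apply]
    exact Finset.sum_comm
  rw [upperProjection, LinearMap.comp_assoc, LinearMap.trace_comp_comm', LinearMap.smul_comp,
    LinearMap.smul_comp, contraction_comp_embedding]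
  simp only [map_smul, map_sum, trace_creation_comp_annihilation, smul_eq_mul,
    Matrix.trace, Matrix.diag, Matrix.mul_apply]

theorem chi_succ (n : ℕ) (u v : SU2) :
    chi n 1 (n + 1) u v = ((n : ℂ) + 1)⁻¹ * (v.1 * ladderTrace n u).trace := by
  rw [chi, projector_succ, trace_upperProjection_comp_map]

theorem chi_pred (n : ℕ) (u v : SU2) :
    chi n 1 (n - 1) u v =
      (rep n).character u * (rep 1).character v - chi n 1 (n + 1) u v := by
  rw [chi, chi, projector_pred, projector_succ, LinearMap.sub_comp, map_sub, LinearMap.id_comp,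
    LinearMap.trace_tensorProduct']
  rfl

theorem ladderTrace_zero (u : SU2) : ladderTrace 0 u = 1 := by
  ext b c
  have comp_eq : annihilation 0 b ∘ₗ creation 0 c ∘ₗ rep 0 u = if b = c then rep 0 u else 0 :=
    LinearMap.ext fun x => by
      simp only [LinearMap.comp_apply, annihilation_creation_zero]
      split_ifs <;> rfl
  rw [ladderTrace, Matrix.of_apply, comp_eq, apply_ite (LinearMap.trace ℂ _), map_zero,
    ← Representation.character, character_rep_zero, Matrix.one_apply]

theorem ladderTrace_succ (n : ℕ) (u : SU2) :
    ladderTrace (n + 1) u = (rep (n + 1)).character u • 1 + u.1 * ladderTrace n u := by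
  ext b c
  have comp_eq : annihilation (n + 1) b ∘ₗ creation (n + 1) c ∘ₗ rep (n + 1) u =
      (if b = c then rep (n + 1) u else 0) +
        ∑ d, u.1 b d • (creation n c ∘ₗ rep n u ∘ₗ annihilation n d) := by
    refine LinearMap.ext fun x => ?_
    simp only [LinearMap.comp_apply, annihilation_creation_succ, annihilation_rep,
      LinearMap.add_apply, LinearMap.sum_apply, LinearMap.smul_apply, map_sum, map_smul]
    split_ifs <;> rfl
  rw [ladderTrace, Matrix.of_apply, comp_eq, map_add, apply_ite (LinearMap.trace ℂ _), map_zero]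
  simp only [map_sum, map_smul, trace_creation_comp_annihilation, Matrix.add_apply,
    Matrix.smul_apply, Matrix.one_apply, Matrix.mul_apply, smul_eq_mul, mul_ite, mul_one, mul_zero]
  rfl

theorem trace_ladderTrace (n : ℕ) (u : SU2) :
    (ladderTrace n u).trace = ((n : ℂ) + 2) * (rep n).character u := by
  have sum_comp_eq :
      ∑ b, annihilation n b ∘ₗ creation n b ∘ₗ rep n u = ((n : ℂ) + 2) • rep n u :=
    LinearMap.ext fun x => by
      simp only [LinearMap.sum_apply, LinearMap.comp_apply, sum_annihilation_creation,
        LinearMap.smul_apply]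
  simp only [Matrix.trace, Matrix.diag, ladderTrace, Matrix.of_apply, Representation.character]
  rw [← map_sum, sum_comp_eq, map_smul, smul_eq_mul]

theorem trace_mul_ladderTrace (n : ℕ) (u : SU2) :
    (u.1 * ladderTrace n u).trace = ((n : ℂ) + 1) * (rep (n + 1)).character u := by
  have h := trace_ladderTrace (n + 1) u
  rw [ladderTrace_succ, Matrix.trace_add, Matrix.trace_smul, Matrix.trace_one, smul_eq_mul,
    Fintype.card_fin] at h
  push_cast at h
  linear_combination h

theorem character_rep_one (u : SU2) : (rep 1).character u = u.1.trace := by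
  have h := trace_mul_ladderTrace 0 u
  rw [ladderTrace_zero, mul_one] at h
  simpa using h.symm

theorem mul_self_eq_trace_smul_sub_one (u : SU2) : u.1 * u.1 = u.1.trace • u.1 - 1 := by
  have h := Matrix.aeval_self_charpoly u.1
  rw [Matrix.charpoly_fin_two, (Matrix.mem_specialUnitaryGroup_iff.1 u.2).2] at h
  simp only [map_add, map_sub, map_mul, map_one, Polynomial.aeval_X, Polynomial.aeval_C,
    ← Algebra.smul_def, sq] at h
  rwa [sub_add, sub_eq_zero] at h

theorem mul_mul_ladderTrace (n : ℕ) (u : SU2) :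
    u.1 * (u.1 * ladderTrace n u) =
      u.1.trace • (u.1 * ladderTrace n u) - ladderTrace n u := by
  rw [← mul_assoc, mul_self_eq_trace_smul_sub_one, sub_mul, one_mul, smul_mul_assoc]

theorem character_rep_add_two (n : ℕ) (u : SU2) :
    (rep (n + 2)).character u =
      u.1.trace * (rep (n + 1)).character u - (rep n).character u := by
  have hn : (n : ℂ) + 2 ≠ 0 := by exact_mod_cast (n + 1).succ_ne_zero
  have h := trace_mul_ladderTrace (n + 1) u
  rw [ladderTrace_succ, mul_add, mul_mul_ladderTrace, Matrix.trace_add, Matrix.trace_sub,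
    mul_smul_comm, mul_one, Matrix.trace_smul, Matrix.trace_smul, trace_ladderTrace,
    trace_mul_ladderTrace] at h
  simp only [smul_eq_mul] at h
  push_cast at h
  refine mul_left_cancel₀ hn ?_
  linear_combination -h

theorem ladderTrace_add_two (n : ℕ) (u : SU2) :
    ladderTrace (n + 2) u = u.1.trace • ladderTrace (n + 1) u - ladderTrace n u +
      (rep (n + 1)).character u • u.1 - (rep n).character u • 1 := by
  rw [ladderTrace_succ (n + 1), ladderTrace_succ n, mul_add, mul_mul_ladderTrace, mul_smul_comm,
    mul_one, character_rep_add_two]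
  module

-- Multiplication by `u` shifts the index of `ladderTrace`, so the identity propagates by induction.
theorem ladderTrace_three_term (n : ℕ) (u : SU2) :
    (((n : ℂ) + 2) * u.1.trace) • ladderTrace (n + 1) u =
      ((n : ℂ) + 1) • ladderTrace (n + 2) u + (rep (n + 2)).character u • 1 +
        ((n : ℂ) + 3) • ladderTrace n u := by
  induction n with
  | zero =>
    rw [ladderTrace_add_two, ladderTrace_succ, ladderTrace_zero, mul_one, character_rep_add_two,
      zero_add, character_rep_one, character_rep_zero]
    push_cast
    module
  | succ n ih =>
    have mul_ladderTrace (k : ℕ) :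
        u.1 * ladderTrace k u = ladderTrace (k + 1) u - (rep (k + 1)).character u • 1 := by
      rw [ladderTrace_succ, add_sub_cancel_left]
    have mul_ih := congrArg (u.1 * ·) ih
    simp only [mul_add, mul_smul_comm, mul_one, mul_ladderTrace] at mul_ih
    push_cast
    linear_combination (norm := module) mul_ih - ladderTrace_add_two (n + 1) u -
      ((n : ℂ) + 2) • character_rep_add_two (n + 1) u • (1 : Matrix (Fin 2) (Fin 2) ℂ)

theorem chi_one_zero_one (u v : SU2) : chi 1 0 1 u v = u.1.trace := by
  rw [chi_zero, character_rep_one]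

theorem chi_mul (j : ℕ) (u v : SU2) :
    chi 1 0 1 u v * chi j 1 (j + 1) u v =
      chi (j + 1) 1 (j + 2) u v + (1 / ((j : ℂ) + 1) ^ 2) * chi (j + 1) 1 j u v +
        ((j : ℂ) * ((j : ℂ) + 2) / ((j : ℂ) + 1) ^ 2) * chi (j - 1) 1 j u v := by
  have chi_lower := chi_pred (j + 1) u v
  rw [Nat.add_sub_cancel] at chi_lower
  rw [chi_one_zero_one, chi_lower]
  cases j with
  | zero =>
    rw [chi_succ 0, ladderTrace_zero, character_rep_one, character_rep_one]
    simp
  | succ m =>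
    have h₁ : (m : ℂ) + 1 ≠ 0 := Nat.cast_add_one_ne_zero m
    have h₂ : (m : ℂ) + 2 ≠ 0 := by exact_mod_cast (m + 1).succ_ne_zero
    have h₃ : (m : ℂ) + 3 ≠ 0 := by exact_mod_cast (m + 2).succ_ne_zero
    have h := congrArg (fun T => (v.1 * T).trace) (ladderTrace_three_term m u)
    simp only [mul_add, mul_smul_comm, mul_one, Matrix.trace_add, Matrix.trace_smul,
      smul_eq_mul] at h
    rw [Nat.add_sub_cancel, chi_succ, chi_succ, chi_succ, character_rep_one]
    push_cast
    rw [show (m : ℂ) + 1 + 1 = m + 2 by ring, show (m : ℂ) + 2 + 1 = m + 3 by ring,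
      show (m : ℂ) + 1 + 2 = m + 3 by ring]
    field_simp
    linear_combination ((m : ℂ) + 3) * h

theorem chi_succ_self (n : ℕ) (u : SU2) : chi n 1 (n + 1) u u = (rep (n + 1)).character u := by
  have hn : (n : ℂ) + 1 ≠ 0 := Nat.cast_add_one_ne_zero n
  rw [chi_succ, trace_mul_ladderTrace, inv_mul_cancel_left₀ hn]

theorem chi_succ_one (n : ℕ) (u : SU2) :
    chi n 1 (n + 1) u 1 = ((n : ℂ) + 2) / ((n : ℂ) + 1) * (rep n).character u := by
  rw [chi_succ, Submonoid.coe_one, one_mul, trace_ladderTrace]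
  ring

theorem chi_pred_one (n : ℕ) (u : SU2) :
    chi n 1 (n - 1) u 1 = (n : ℂ) / ((n : ℂ) + 1) * (rep n).character u := by
  have hn : (n : ℂ) + 1 ≠ 0 := Nat.cast_add_one_ne_zero n
  rw [chi_pred, chi_succ_one, character_rep_one, Submonoid.coe_one, Matrix.trace_one,
    Fintype.card_fin]
  field_simp
  push_cast
  ring

theorem chi_zero_one_zero (u v : SU2) : chi 0 1 0 u v = 0 := by
  rw [chi_pred 0 u v, chi_succ, ladderTrace_zero, character_rep_zero, character_rep_one]
  simp

theorem chi_pred_self (n : ℕ) (u : SU2) :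
    chi (n + 1) 1 n u u = (rep n).character u := by
  have chi_lower := chi_pred (n + 1) u u
  rw [Nat.add_sub_cancel] at chi_lower
  rw [chi_lower, chi_succ_self, character_rep_add_two, character_rep_one]
  ring

/-! ### Linear independence -/

theorem character_rep_eq_eval_U (n : ℕ) (u : SU2) :
    (rep n).character u = (Polynomial.Chebyshev.U ℂ n).eval (u.1.trace / 2) := by
  induction n using Nat.twoStepInduction with
  | zero => simp [character_rep_zero]
  | one => simp [character_rep_one, mul_div_cancel₀]
  | more n ih ih' =>
    rw [character_rep_add_two, ih, ih']
    push_cast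
    rw [Polynomial.Chebyshev.U_add_two]
    simp only [Polynomial.eval_sub, Polynomial.eval_mul, Polynomial.eval_ofNat, Polynomial.eval_X]
    ring

theorem infinite_range_half_trace : (Set.range fun u : SU2 => u.1.trace / 2).Infinite := by
  refine ((Set.Icc_infinite one_pos).image Complex.ofReal_injective.injOn).mono ?_
  rintro _ ⟨x, ⟨h₀, h₁⟩, rfl⟩
  have norm_sq_add : ‖(x : ℂ)‖ ^ 2 + ‖(√(1 - x ^ 2) : ℂ)‖ ^ 2 = 1 := by
    rw [Complex.norm_real, Complex.norm_real, Real.norm_eq_abs, Real.norm_eq_abs, sq_abs, sq_abs,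
      Real.sq_sqrt (by nlinarith), add_sub_cancel]
  refine ⟨mkSU2 _ _ norm_sq_add, ?_⟩
  simp [mkSU2, Matrix.trace_fin_two]

theorem linearIndependent_character_rep : LinearIndependent ℂ fun n => (rep n).character := by
  let U : Polynomial.Sequence ℂ :=
    ⟨fun n => Polynomial.Chebyshev.U ℂ n, Polynomial.Chebyshev.degree_U_natCast ℂ⟩
  let evalHalfTrace : Polynomial ℂ →ₗ[ℂ] SU2 → ℂ :=
    LinearMap.pi fun u => Polynomial.leval (u.1.trace / 2)
  have ker_eq_bot : LinearMap.ker evalHalfTrace = ⊥ := LinearMap.ker_eq_bot'.2 fun p hp =>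
    p.eq_zero_of_infinite_isRoot <| infinite_range_half_trace.mono <| by
      rintro _ ⟨u, rfl⟩
      exact congrFun hp u
  have map_U : (fun n => (rep n).character) = evalHalfTrace ∘ U :=
    funext fun n => funext fun u => character_rep_eq_eval_U n u
  rw [map_U]
  exact U.linearIndependent.map' evalHalfTrace ker_eq_bot

/-- The linear span of the characters of label less than `n`. -/
def characterSpan (n : ℕ) : Submodule ℂ (SU2 → ℂ) :=
  Submodule.span ℂ ((fun m => (rep m).character) '' Set.Iio n)

theorem character_mem_characterSpan {m n : ℕ} (h : m < n) :
    (rep m).character ∈ characterSpan n :=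
  Submodule.subset_span ⟨m, h, rfl⟩

theorem characterSpan_mono : Monotone characterSpan :=
  fun _ _ h => Submodule.span_mono (Set.image_mono (Set.Iio_subset_Iio h))

theorem eq_zero_of_smul_character_mem {n : ℕ} {a : ℂ}
    (h : a • (rep n).character ∈ characterSpan n) : a = 0 := by
  by_contra ha
  exact linearIndependent_character_rep.notMem_span_image (s := Set.Iio n) Set.self_notMem_Iio
    ((Submodule.smul_mem_iff _ ha).1 h)

/-- The linear span of the quasicharacters `chi m 1 l` with `m < n`. -/
def quasicharacterSpan (n : ℕ) : Submodule ℂ (SU2 → SU2 → ℂ) :=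
  Submodule.span ℂ {f | ∃ m < n, f = chi m 1 (m + 1) ∨ f = chi m 1 (m - 1)}

/-- Restriction of functions of two variables to the graph of `φ`. -/
def restrictGraph (φ : SU2 → SU2) : (SU2 → SU2 → ℂ) →ₗ[ℂ] SU2 → ℂ :=
  LinearMap.pi fun u => LinearMap.proj (φ u) ∘ₗ LinearMap.proj u

theorem restrictGraph_id_chi_succ (n : ℕ) :
    restrictGraph id (chi n 1 (n + 1)) = (rep (n + 1)).character :=
  funext (chi_succ_self n)

theorem restrictGraph_id_chi_pred_mem (n : ℕ) :
    restrictGraph id (chi n 1 (n - 1)) ∈ characterSpan n := by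
  cases n with
  | zero =>
    rw [show restrictGraph id (chi 0 1 (0 - 1)) = 0 from funext fun u => chi_zero_one_zero u u]
    exact zero_mem _
  | succ n =>
    rw [show restrictGraph id (chi (n + 1) 1 (n + 1 - 1)) = (rep n).character from
      funext (chi_pred_self n)]
    exact character_mem_characterSpan n.lt_succ_self

theorem map_restrictGraph_id_quasicharacterSpan_le (n : ℕ) :
    (quasicharacterSpan n).map (restrictGraph id) ≤ characterSpan (n + 1) := by
  rw [quasicharacterSpan, Submodule.map_span_le]
  rintro _ ⟨m, hm, rfl | rfl⟩
  · rw [restrictGraph_id_chi_succ]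
    exact character_mem_characterSpan (Nat.succ_lt_succ hm)
  · exact characterSpan_mono (hm.le.trans n.le_succ) (restrictGraph_id_chi_pred_mem m)

theorem restrictGraph_one_chi_succ (n : ℕ) :
    restrictGraph 1 (chi n 1 (n + 1)) = (((n : ℂ) + 2) / ((n : ℂ) + 1)) • (rep n).character :=
  funext (chi_succ_one n)

theorem restrictGraph_one_chi_pred (n : ℕ) :
    restrictGraph 1 (chi n 1 (n - 1)) = ((n : ℂ) / ((n : ℂ) + 1)) • (rep n).character :=
  funext (chi_pred_one n)

theorem map_restrictGraph_one_quasicharacterSpan_le (n : ℕ) :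
    (quasicharacterSpan n).map (restrictGraph 1) ≤ characterSpan n := by
  rw [quasicharacterSpan, Submodule.map_span_le]
  rintro _ ⟨m, hm, rfl | rfl⟩
  · rw [restrictGraph_one_chi_succ]
    exact Submodule.smul_mem _ _ (character_mem_characterSpan hm)
  · rw [restrictGraph_one_chi_pred]
    exact Submodule.smul_mem _ _ (character_mem_characterSpan hm)

theorem eq_zero_of_smul_chi_add_smul_chi_mem {n : ℕ} {a b : ℂ}
    (h : a • chi n 1 (n + 1) + b • chi n 1 (n - 1) ∈ quasicharacterSpan n) :
    a = 0 ∧ (n ≠ 0 → b = 0) := by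
  have a_eq_zero : a = 0 := by
    have diagonal_mem :=
      map_restrictGraph_id_quasicharacterSpan_le n (Submodule.mem_map_of_mem h)
    rw [map_add, map_smul, map_smul, restrictGraph_id_chi_succ] at diagonal_mem
    have pred_mem := (characterSpan (n + 1)).smul_mem b
      (characterSpan_mono n.le_succ (restrictGraph_id_chi_pred_mem n))
    exact eq_zero_of_smul_character_mem ((Submodule.add_mem_iff_left _ pred_mem).1 diagonal_mem)
  refine ⟨a_eq_zero, fun hn => ?_⟩
  have one_mem := map_restrictGraph_one_quasicharacterSpan_le n (Submodule.mem_map_of_mem h)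
  rw [a_eq_zero, zero_smul, zero_add, map_smul, restrictGraph_one_chi_pred, smul_smul] at one_mem
  have factor_ne_zero : (n : ℂ) / ((n : ℂ) + 1) ≠ 0 :=
    div_ne_zero (Nat.cast_ne_zero.2 hn) (Nat.cast_add_one_ne_zero n)
  exact (mul_eq_zero.1 (eq_zero_of_smul_character_mem one_mem)).resolve_right factor_ne_zero

theorem chi_succ_mem_quasicharacterSpan {m n : ℕ} (h : m < n) :
    chi m 1 (m + 1) ∈ quasicharacterSpan n :=
  Submodule.subset_span ⟨m, h, .inl rfl⟩

theorem chi_pred_mem_quasicharacterSpan {m n : ℕ} (h : m < n) :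
    chi m 1 (m - 1) ∈ quasicharacterSpan n :=
  Submodule.subset_span ⟨m, h, .inr rfl⟩

theorem coeff_eq_of_combination_eq {j : ℕ} {c₁ c₂ c₃ c₄ d₁ d₂ d₃ d₄ : ℂ}
    (h : c₁ • chi (j + 1) 1 (j + 2) + c₂ • chi (j + 1) 1 j +
        c₃ • chi (j - 1) 1 j + c₄ • chi (j - 1) 1 (j - 2) =
      d₁ • chi (j + 1) 1 (j + 2) + d₂ • chi (j + 1) 1 j +
        d₃ • chi (j - 1) 1 j + d₄ • chi (j - 1) 1 (j - 2)) :
    c₁ = d₁ ∧ c₂ = d₂ ∧ (1 ≤ j → c₃ = d₃) ∧ (2 ≤ j → c₄ = d₄) := by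
  have upper_eq : (c₁ - d₁) • chi (j + 1) 1 (j + 2) + (c₂ - d₂) • chi (j + 1) 1 j =
      -((c₃ - d₃) • chi (j - 1) 1 j + (c₄ - d₄) • chi (j - 1) 1 (j - 2)) := by
    linear_combination (norm := module) h
  have lower_mem : chi (j - 1) 1 j ∈ quasicharacterSpan (j + 1) := by
    cases j with
    | zero => exact chi_pred_mem_quasicharacterSpan one_pos
    | succ m => exact chi_succ_mem_quasicharacterSpan (by lia)
  have lower_mem' : chi (j - 1) 1 (j - 2) ∈ quasicharacterSpan (j + 1) :=
    chi_pred_mem_quasicharacterSpan (m := j - 1) (by lia)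
  obtain ⟨h₁, h₂⟩ := eq_zero_of_smul_chi_add_smul_chi_mem (n := j + 1) <| upper_eq ▸
    neg_mem (add_mem (Submodule.smul_mem _ _ lower_mem) (Submodule.smul_mem _ _ lower_mem'))
  have h₂ := h₂ j.succ_ne_zero
  refine ⟨sub_eq_zero.1 h₁, sub_eq_zero.1 h₂, ?_⟩
  rw [h₁, h₂, zero_smul, zero_smul, zero_add, zero_eq_neg] at upper_eq
  cases j with
  | zero => exact ⟨by lia, by lia⟩
  | succ m =>
    obtain ⟨h₃, h₄⟩ := eq_zero_of_smul_chi_add_smul_chi_mem (n := m) (upper_eq ▸ zero_mem _)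
    exact ⟨fun _ => sub_eq_zero.1 h₃, fun hm => sub_eq_zero.1 (h₄ (by lia))⟩

end

end Quasicharacter

open Quasicharacter in
/-- Expansion of the pointwise product `χ^1_{1,0} · χ^{j+1}_{j,1}`, where `χ^1_{1,0}(u,v) = Tr u`,
and uniqueness of the coefficients. Here `chi j k l` is `χ^l_{j,k}`. For `j = 0` the term of label
`(j-1, 1; j)`, and for `j ≤ 1` the term of label `(j-1, 1; j-2)`, is absent in the usual sense; in
the formula it has coefficient `0`. -/
theorem mainTheorem2 (j : ℕ) :
    (∀ u v : SU2, chi 1 0 1 u v = Matrix.trace (u : Matrix (Fin 2) (Fin 2) ℂ)) ∧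
    (∀ u v : SU2,
      chi 1 0 1 u v * chi j 1 (j + 1) u v =
        chi (j + 1) 1 (j + 2) u v
          + (1 / ((j : ℂ) + 1) ^ 2) * chi (j + 1) 1 j u v
          + ((j : ℂ) * ((j : ℂ) + 2) / ((j : ℂ) + 1) ^ 2) * chi (j - 1) 1 j u v
          + 0 * chi (j - 1) 1 (j - 2) u v) ∧
    (∀ c₁ c₂ c₃ c₄ : ℂ,
      (∀ u v : SU2,
        chi 1 0 1 u v * chi j 1 (j + 1) u v =
          c₁ * chi (j + 1) 1 (j + 2) u v + c₂ * chi (j + 1) 1 j u v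
            + c₃ * chi (j - 1) 1 j u v + c₄ * chi (j - 1) 1 (j - 2) u v) →
      c₁ = 1 ∧ c₂ = 1 / ((j : ℂ) + 1) ^ 2 ∧
        (1 ≤ j → c₃ = (j : ℂ) * ((j : ℂ) + 2) / ((j : ℂ) + 1) ^ 2) ∧
        (2 ≤ j → c₄ = 0)) := by
  refine ⟨chi_one_zero_one, fun u v => ?_, fun c₁ c₂ c₃ c₄ h => ?_⟩
  · rw [chi_mul, zero_mul, add_zero]
  · refine coeff_eq_of_combination_eq (funext fun u => funext fun v => ?_)
    simp only [Pi.add_apply, Pi.smul_apply, smul_eq_mul]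
    rw [← h, chi_mul, one_mul, zero_mul, add_zero]
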